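/- Let $R$ be an $h$-local Prüfer domain, that is, an integral domain such that (a) every finitely generated ideal of $R$ is projective, (b) every nonzero prime ideal of $R$ is contained in exactly one maximal ideal, and (c) every nonzero element of $R$ is contained in only finitely many maximal ideals. A submodule $N$ of an $R$-module $X$ is called pure in $X$ if every finite system of equations $\sum_{j=1}^m r_{ij}x_j=a_i$ ($i=1,\dots,n$), with $r_{ij}\in R$ and $a_i\in N$, that is solvable in $X$ is solvable in $N$. A $G(\aleph_0)$-family of an $R$-module $X$ is a family $\mathcal B$ of submodules of $X$ such that $0,X\in\mathcal B$; $\mathcal B$ is closed under unions of ascending chains of arbitrary length; and for every $A_0\in\mathcal B$ and every countable subset $H\subseteq X$ there is $A\in\mathcal B$ with $A_0\subseteq A$, $H\subseteq A$ and $A/A_0$ countably generated. Direct sums may have arbitrarily many summands. Let $M$ be a torsion-free $R$-module that is the union of a countable ascending chain $$0=M_0\le M_1\le\dots\le M_n\le\cdots\qquad(n<\omega)$$ of submodules such that, for every $n<\omega$, 1. $M_n$ is isomorphic to a direct sum of ideals of $R$, 2. $M_{n+1}/M_n$ has a $G(\aleph_0)$-family consisting of pure submodules of $M_{n+1}/M_n$,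 and 3. $M_n$ is pure in $M$. Then $M$ is isomorphic to a direct sum of ideals of $R$. -/

import Mathlib

open scoped DirectSum

universe u v

/-- A Prüfer domain: an integral domain all of whose finitely generated ideals are projective. -/
def IsPruferDomain (R : Type u) [CommRing R] : Prop :=
  IsDomain R ∧ ∀ I : Ideal R, I.FG → Module.Projective R I

/-- An `h`-local domain: an integral domain in which every nonzero prime ideal lies in exactly one
maximal ideal and every nonzero element lies in only finitely many maximal ideals. -/
def IsHLocalDomain (R : Type u) [CommRing R] : Prop :=
  IsDomain R ∧
  (∀ P : Ideal R, P.IsPrime → P ≠ ⊥ → ∃! m : Ideal R, m.IsMaximal ∧ P ≤ m) ∧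
  (∀ r : R, r ≠ 0 → {m : Ideal R | m.IsMaximal ∧ r ∈ m}.Finite)

/-- `N` is pure in `M`: every finite system of linear equations with right-hand sides in `N` that
is solvable in `M` is solvable in `N`. -/
def IsPureSubmodule {R : Type u} {M : Type v} [CommRing R] [AddCommGroup M] [Module R M]
    (N : Submodule R M) : Prop :=
  ∀ (n m : ℕ) (r : Fin n → Fin m → R) (a : Fin n → M), (∀ i, a i ∈ N) →
    (∃ x : Fin m → M, ∀ i, ∑ j, r i j • x j = a i) →
    ∃ y : Fin m → M, (∀ j, y j ∈ N) ∧ ∀ i, ∑ j, r i j • y j = a i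

/-- `M` is isomorphic to a (not necessarily finite) direct sum of ideals of `R`. The index type is
taken in the universe of `M`, which is no restriction: the index set of the nonzero summands
injects into `M`. -/
def IsIsoDirectSumOfIdeals (R : Type u) (M : Type v) [CommRing R] [AddCommGroup M] [Module R M] :
    Prop :=
  ∃ (ι : Type v) (I : ι → Ideal R), Nonempty (M ≃ₗ[R] ⨁ i, ↥(I i))

/-- A `G(ℵ₀)`-family of submodules of `M`. In the last field, `A / A₀` is `A.map A₀.mkQ`, a
submodule of `M ⧸ A₀`. -/
structure IsGAlephZeroFamily {R : Type u} {M : Type v} [CommRing R] [AddCommGroup M] [Module R M]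
    (B : Set (Submodule R M)) : Prop where
  bot_mem : ⊥ ∈ B
  top_mem : ⊤ ∈ B
  /-- Closure under unions of chains (the supremum of a nonempty chain is its union). -/
  sSup_mem : ∀ c : Set (Submodule R M), c ⊆ B → c.Nonempty → IsChain (· ≤ ·) c → sSup c ∈ B
  exists_countable_extension : ∀ A₀ ∈ B, ∀ H : Set M, H.Countable →
    ∃ A ∈ B, A₀ ≤ A ∧ H ⊆ A ∧
      ∃ S : Set (M ⧸ A₀), S.Countable ∧ Submodule.span R S = A.map A₀.mkQ

/-!
The proof is a version of Hill's argument for unions of chains of pure free subgroups.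

*Algebra.* Over an `h`-local Prüfer domain a pure submodule `J` of rank one in a direct sum of
ideals is a direct summand, and is isomorphic to an ideal
(`exists_projection_pureClosure_singleton`, `exists_injective_pureClosure_singleton`). At a maximal
ideal `m` the ring `R_m` is a valuation ring, so one coordinate of a generator of `J` dominates the
others, and projecting to that coordinate maps `J_m` isomorphically onto the whole coordinate ideal;
the `h`-local condition lets one lift this local splitting to `R` with a denominator outside `m`
(`IsHLocalDomain.exists_uniform_of_fracLEAt`), and the local splittings add up to a global one.

*Countable extensions.* Call `B ≤ M` well placed if, for all large `n`, `B ⊓ A n` is a direct summand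
of `A n` and `M ⧸ (B ⊔ A n)` is torsion-free. If `x ∈ A n`, the pure closure of `B + R x` is then
generated by `B` and its intersection with `A n`, so by the algebraic step it is `B ⊕ J` with `J`
isomorphic to an ideal, and it is again well placed (`IsWellPlaced.adjoin`). Repeating this, every
pure extension of countable rank of `B` is `B` plus a direct sum of ideals
(`IsWellPlaced.exists_sSupIndep`).

*Exhausting `M`.* Well-placed submodules need not be closed under unions of chains, but adapted ones
are: those that meet every `A n` in a partial sum of a fixed decomposition, and whose trace on every
`A (n + 1) ⧸ A n` belongs to the given `G(ℵ₀)`-family. Adapted submodules are well placed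
(`IsAdapted.isWellPlaced`), and a back-and-forth argument shows that each has adapted extensions of
countable rank containing any given element (`IsAdapted.exists_countable_extension`). Zorn's lemma,
applied to the independent sets of submodules that embed in `R` and whose sum is adapted, therefore
yields such a set with sum `M`.
-/

/-! ### Divisibility in `h`-local Prüfer domains -/

section Ring

variable {R : Type u} [CommRing R]

/-- Localizations of a Prüfer domain at maximal ideals are valuation rings: of two elements one
divides the other, up to a multiplier outside `m`. The coefficients come from a splitting of
`R² → (a, b)`. -/
theorem IsPruferDomain.exists_notMem_dvd_or_dvd (hR : IsPruferDomain R) (m : Ideal R)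
    [hm : m.IsPrime] (a b : R) : ∃ u ∉ m, a ∣ u * b ∨ b ∣ u * a := by
  have ha : a ∈ Ideal.span {a, b} := Ideal.subset_span (by simp)
  have hb : b ∈ Ideal.span {a, b} := Ideal.subset_span (by simp)
  have := hR.2 (Ideal.span {a, b}) (Submodule.fg_span (Set.toFinite _))
  let f : R × R →ₗ[R] Ideal.span {a, b} :=
    (LinearMap.toSpanSingleton R _ ⟨a, ha⟩).coprod (LinearMap.toSpanSingleton R _ ⟨b, hb⟩)
  have hf : Function.Surjective f := by
    rintro ⟨x, hx⟩
    obtain ⟨p, q, rfl⟩ := Ideal.mem_span_pair.1 hx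
    exact ⟨(p, q), Subtype.ext (by simp [f])⟩
  obtain ⟨g, hg⟩ := Module.projective_lifting_property f LinearMap.id hf
  have hga : (g ⟨a, ha⟩).1 * a + (g ⟨a, ha⟩).2 * b = a := by
    simpa [f] using congrArg Subtype.val (LinearMap.congr_fun hg ⟨a, ha⟩)
  have hab : b * (g ⟨a, ha⟩).1 = a * (g ⟨b, hb⟩).1 := by
    have h : b • (⟨a, ha⟩ : Ideal.span {a, b}) = a • ⟨b, hb⟩ := Subtype.ext (mul_comm b a)
    have h' := congrArg (fun z => (g z).1) h
    simpa only [map_smul, Prod.smul_fst, smul_eq_mul] using h'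
  by_cases h : (g ⟨a, ha⟩).1 ∈ m
  · refine ⟨1 - (g ⟨a, ha⟩).1, fun h' => hm.ne_top ?_, .inr ⟨(g ⟨a, ha⟩).2, ?_⟩⟩
    · exact (Ideal.eq_top_iff_one m).2 (by simpa using add_mem h' h)
    · linear_combination -hga
  · exact ⟨_, h, .inl ⟨(g ⟨b, hb⟩).1, by rw [mul_comm, hab]⟩⟩

/-- Distinct maximal ideals of an `h`-local domain are independent: `R_m R_{m'}` is the field of
fractions. Otherwise a prime containing `r` would lie in `m ∩ m'`. -/
theorem IsHLocalDomain.exists_notMem_mul_dvd (hR : IsHLocalDomain R) {m m' : Ideal R}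
    (hm : m.IsMaximal) (hm' : m'.IsMaximal) (hne : m ≠ m') {r : R} (hr : r ≠ 0) :
    ∃ s ∉ m, ∃ s' ∉ m', r ∣ s * s' := by
  by_contra! h
  have := hm.isPrime
  have := hm'.isPrime
  have hd : Disjoint (Ideal.span {r} : Set R)
      ((m.primeCompl ⊔ m'.primeCompl : Submonoid R) : Set R) := by
    rw [Set.disjoint_left]
    intro x hx hx'
    obtain ⟨s, hs, s', hs', rfl⟩ := Submonoid.mem_sup.1 hx'
    exact h s hs s' hs' (Ideal.mem_span_singleton.1 hx)
  obtain ⟨P, hP, hrP, hPd⟩ := Ideal.exists_le_prime_disjoint _ _ hd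
  have hrP' : r ∈ P := hrP (Ideal.mem_span_singleton_self r)
  have hPm : P ≤ m := fun x hx => by
    by_contra hxm
    exact Set.disjoint_left.1 hPd hx ((le_sup_left : m.primeCompl ≤ _) hxm)
  have hPm' : P ≤ m' := fun x hx => by
    by_contra hxm
    exact Set.disjoint_left.1 hPd hx ((le_sup_right : m'.primeCompl ≤ _) hxm)
  exact hne ((hR.2.1 P hP (fun h0 => hr (by simpa [h0] using hrP'))).unique ⟨hm, hPm⟩ ⟨hm', hPm'⟩)

/-- For nonzero `a` and `b`: the inclusion `a⁻¹ I ⊆ b⁻¹ J` of fractional ideals after localization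
at `m`, with denominators cleared. -/
def FracLEAt (m I J : Ideal R) (a b : R) : Prop :=
  ∀ z ∈ I, ∃ u ∉ m, ∃ w ∈ J, u * z * b = a * w

theorem FracLEAt.refl {m : Ideal R} (hm : m ≠ ⊤) (I : Ideal R) (a : R) : FracLEAt m I I a a :=
  fun z hz => ⟨1, (Ideal.ne_top_iff_one m).1 hm, z, hz, by ring⟩

theorem FracLEAt.trans [IsDomain R] {m I J K : Ideal R} [hm : m.IsPrime] {a b c : R} (hb : b ≠ 0)
    (h₁ : FracLEAt m I J a b) (h₂ : FracLEAt m J K b c) : FracLEAt m I K a c := by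
  intro z hz
  obtain ⟨u, hu, w, hw, h⟩ := h₁ z hz
  obtain ⟨u', hu', w', hw', h'⟩ := h₂ w hw
  refine ⟨u * u', fun h => (hm.mem_or_mem h).elim hu hu', w', hw', mul_left_cancel₀ hb ?_⟩
  linear_combination (u' * c) * h + a * h'

theorem IsPruferDomain.fracLEAt_total (hR : IsPruferDomain R) (m I J : Ideal R) [m.IsPrime]
    (a b : R) : FracLEAt m I J a b ∨ FracLEAt m J I b a := by
  by_contra! h
  obtain ⟨h₁, h₂⟩ := h
  simp only [FracLEAt] at h₁
  push Not at h₁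
  obtain ⟨z, hz, h₁⟩ := h₁
  refine h₂ fun w hw => ?_
  obtain ⟨u, hu, ⟨v, hv⟩ | ⟨v, hv⟩⟩ := hR.exists_notMem_dvd_or_dvd m (a * w) (z * b)
  · exact (h₁ u hu (w * v) (J.mul_mem_right v hw) (by linear_combination hv)).elim
  · exact ⟨u, hu, z * v, I.mul_mem_right v hz, by linear_combination hv⟩

theorem IsPruferDomain.exists_fracLEAt_forall (hR : IsPruferDomain R) (m : Ideal R)
    [hm : m.IsPrime] {ι : Type*} (I : ι → Ideal R) (c : ι → R) (s : Finset ι) (hs : s.Nonempty)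
    (hc : ∀ i ∈ s, c i ≠ 0) : ∃ k ∈ s, ∀ i ∈ s, FracLEAt m (I k) (I i) (c k) (c i) := by
  have := hR.1
  induction hs using Finset.Nonempty.cons_induction with
  | singleton a => exact ⟨a, by simp, by simpa using FracLEAt.refl hm.ne_top _ _⟩
  | cons a s ha hs ih =>
    obtain ⟨k, hk, hmin⟩ := ih fun i hi => hc i (by simp [hi])
    rcases hR.fracLEAt_total m (I k) (I a) (c k) (c a) with h | h
    · refine ⟨k, by simp [hk], fun i hi => ?_⟩
      rcases Finset.mem_cons.1 hi with rfl | hi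
      · exact h
      · exact hmin i hi
    · refine ⟨a, by simp, fun i hi => ?_⟩
      rcases Finset.mem_cons.1 hi with rfl | hi
      · exact FracLEAt.refl hm.ne_top _ _
      · exact h.trans (hc k (by simp [hk])) (hmin i hi)

/-- Over an `h`-local domain the multiplier in `FracLEAt` can be chosen uniformly: residuals of
fractional ideals commute with localization. -/
theorem IsHLocalDomain.exists_uniform_of_fracLEAt (hR : IsHLocalDomain R) {m I J : Ideal R}
    (hm : m.IsMaximal) {a b : R} (ha : a ≠ 0) (hb : b ≠ 0) (hbJ : b ∈ J)
    (h : FracLEAt m I J a b) : ∃ t ∉ m, ∀ z ∈ I, ∃ w ∈ J, t * z * b = a * w := by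
  have := hR.1
  have := hm.isPrime
  have hr : a * b ≠ 0 := mul_ne_zero ha hb
  -- Off the finitely many maximal ideals containing `a * b`, the multiplier `a * b` itself works.
  have hfin : {n : Ideal R | n.IsMaximal ∧ a * b ∈ n ∧ n ≠ m}.Finite :=
    (hR.2.2 _ hr).subset fun n hn => ⟨hn.1, hn.2.1⟩
  have hind : ∀ n : Ideal R, ∃ s ∉ m, n ∈ hfin.toFinset → ∃ s' ∉ n, a * b ∣ s * s' := fun n => by
    by_cases hn : n ∈ hfin.toFinset
    · have hn' := hfin.mem_toFinset.1 hn
      obtain ⟨s, hs, hs'⟩ := hR.exists_notMem_mul_dvd hm hn'.1 hn'.2.2.symm hr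
      exact ⟨s, hs, fun _ => hs'⟩
    · exact ⟨1, (Ideal.ne_top_iff_one m).1 hm.ne_top, fun h => (hn h).elim⟩
  choose s hs hs' using hind
  refine ⟨∏ n ∈ hfin.toFinset, s n, fun hmem => ?_, fun z hz => ?_⟩
  · obtain ⟨n, -, hn⟩ := Ideal.IsPrime.prod_mem_iff.1 hmem
    exact hs n hn
  set t := ∏ n ∈ hfin.toFinset, s n with ht
  let 𝔟 : Ideal R :=
    { carrier := {v | ∃ w ∈ J, v * (t * z * b) = a * w}
      zero_mem' := ⟨0, J.zero_mem, by simp⟩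
      add_mem' := by
        rintro v v' ⟨w, hw, h⟩ ⟨w', hw', h'⟩
        exact ⟨w + w', J.add_mem hw hw', by linear_combination h + h'⟩
      smul_mem' := by
        rintro x v ⟨w, hw, h⟩
        exact ⟨x * w, J.mul_mem_left x hw, by rw [smul_eq_mul]; linear_combination x * h⟩ }
  suffices h𝔟 : 𝔟 = ⊤ by
    obtain ⟨w, hw, h⟩ := (Ideal.eq_top_iff_one 𝔟).1 h𝔟
    exact ⟨w, hw, by linear_combination h⟩
  by_contra htop
  obtain ⟨n, hn, h𝔟n⟩ := Ideal.exists_le_maximal 𝔟 htop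
  by_cases hnm : n = m
  · subst hnm
    obtain ⟨u, hu, w, hw, h⟩ := h z hz
    exact hu (h𝔟n ⟨t * w, J.mul_mem_left t hw, by linear_combination t * h⟩)
  by_cases hrn : a * b ∈ n
  · have hn' : n ∈ hfin.toFinset := hfin.mem_toFinset.2 ⟨hn, hrn, hnm⟩
    obtain ⟨s', hs'n, hdvd⟩ := hs' n hn'
    have hdvd' : a * b ∣ s' * t := by
      rw [mul_comm s']
      exact hdvd.trans (mul_dvd_mul_right (Finset.dvd_prod_of_mem s hn') s')
    obtain ⟨y, hy⟩ := hdvd'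
    exact hs'n (h𝔟n ⟨b * (y * z * b), J.mul_mem_right _ hbJ, by linear_combination (z * b) * hy⟩)
  · exact hrn (h𝔟n ⟨b * (t * z * b), J.mul_mem_right _ hbJ, by ring⟩)

end Ring

/-! ### Relatively divisible submodules and pure closures -/

section PureClosure

variable {R : Type u} {M : Type v} [CommRing R] [AddCommGroup M] [Module R M]

/-- `N` is relatively divisible in `M`: `M ⧸ N` has no torsion. In a torsion-free module over a
domain this is the only consequence of purity that matters. -/
def IsRelDivisible (N : Submodule R M) : Prop :=
  ∀ r : R, r ≠ 0 → ∀ x : M, r • x ∈ N → x ∈ N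

theorem IsPureSubmodule.isRelDivisible [IsDomain R] [Module.IsTorsionFree R M] {N : Submodule R M}
    (hN : IsPureSubmodule N) : IsRelDivisible N := by
  intro r hr x hx
  obtain ⟨y, hy, h⟩ := hN 1 1 (fun _ _ => r) (fun _ => r • x) (fun _ => hx) ⟨fun _ => x, by simp⟩
  have h0 : y 0 = x := smul_right_injective M hr (by simpa using h 0)
  exact h0 ▸ hy 0

variable [IsDomain R]

/-- The pure closure of `N` in `M`: the preimage of the torsion submodule of `M ⧸ N`. -/
def pureClosure (N : Submodule R M) : Submodule R M where
  carrier := {x | ∃ r : R, r ≠ 0 ∧ r • x ∈ N}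
  zero_mem' := ⟨1, one_ne_zero, by simp⟩
  add_mem' := by
    rintro x y ⟨r, hr, hx⟩ ⟨s, hs, hy⟩
    refine ⟨r * s, mul_ne_zero hr hs, ?_⟩
    rw [smul_add]
    refine N.add_mem ?_ ?_
    · rw [mul_comm, mul_smul]; exact N.smul_mem _ hx
    · rw [mul_smul]; exact N.smul_mem _ hy
  smul_mem' := by
    rintro a x ⟨r, hr, hx⟩
    exact ⟨r, hr, by rw [smul_comm]; exact N.smul_mem _ hx⟩

theorem le_pureClosure (N : Submodule R M) : N ≤ pureClosure N :=
  fun x hx => ⟨1, one_ne_zero, by simpa using hx⟩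

theorem isRelDivisible_pureClosure (N : Submodule R M) : IsRelDivisible (pureClosure N) := by
  rintro r hr x ⟨s, hs, hx⟩
  exact ⟨s * r, mul_ne_zero hs hr, by rwa [mul_smul]⟩

theorem pureClosure_le {N P : Submodule R M} (hP : IsRelDivisible P) (h : N ≤ P) :
    pureClosure N ≤ P := by
  rintro x ⟨r, hr, hx⟩
  exact hP r hr x (h hx)

theorem pureClosure_mono {N P : Submodule R M} (h : N ≤ P) : pureClosure N ≤ pureClosure P :=
  pureClosure_le (isRelDivisible_pureClosure P) (h.trans (le_pureClosure P))

end PureClosure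

/-! ### Rank-one pure submodules of direct sums of ideals -/

section RankOne

variable {R : Type u} {G : Type v} [CommRing R] [IsDomain R] [AddCommGroup G] [Module R G]

variable {ι : Type*} {I : ι → Ideal R}

theorem coord_mul_coord_of_mem_pureClosure (e : G ≃ₗ[R] ⨁ i, ↥(I i)) {c x : G}
    (hx : x ∈ pureClosure (R ∙ c)) (i j : ι) :
    (e c i : R) * e x j = e c j * e x i := by
  obtain ⟨r, hr, hx⟩ := hx
  obtain ⟨a, ha⟩ := Submodule.mem_span_singleton.1 hx
  have h : ∀ k, a * (e c k : R) = r * e x k := fun k => by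
    have := congrArg (fun y => ((e y k : I k) : R)) ha
    simpa only [map_smul, DirectSum.smul_apply, SetLike.val_smul, smul_eq_mul] using this
  refine mul_left_cancel₀ hr ?_
  linear_combination e c j * h i - e c i * h j

theorem smul_eq_coord_smul_of_mem_pureClosure (e : G ≃ₗ[R] ⨁ i, ↥(I i)) {c x : G}
    (hx : x ∈ pureClosure (R ∙ c)) (k : ι) : (e c k : R) • x = (e x k : R) • c := by
  apply e.injective
  refine DFinsupp.ext fun i => Subtype.ext ?_
  have := coord_mul_coord_of_mem_pureClosure e hx k i
  simp only [map_smul, DirectSum.smul_apply, SetLike.val_smul, smul_eq_mul]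
  linear_combination this

variable [Module.IsTorsionFree R G]

/-- A linear map whose values are divisible by `a ≠ 0` can be divided by `a`. -/
theorem LinearMap.exists_smul_eq {a : R} (ha : a ≠ 0) (ψ : G →ₗ[R] G)
    (h : ∀ x, ∃ w, a • w = ψ x) : ∃ φ : G →ₗ[R] G, ∀ x, a • φ x = ψ x := by
  choose f hf using h
  refine ⟨{ toFun := f, map_add' := fun x y => ?_, map_smul' := fun r x => ?_ }, hf⟩
  · exact smul_right_injective G ha (by simp [hf, smul_add])
  · refine smul_right_injective G ha ?_
    simp only [hf, RingHom.id_apply, map_smul, smul_comm a r]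

/-- A pure submodule of rank one of a direct sum of ideals embeds in `R`, through any coordinate
that does not vanish on a generator. -/
theorem exists_injective_pureClosure_singleton (e : G ≃ₗ[R] ⨁ i, ↥(I i)) (c : G) :
    ∃ f : pureClosure (R ∙ c) →ₗ[R] R, Function.Injective f := by
  by_cases hc : ∃ k, (e c k : R) ≠ 0
  · obtain ⟨k, hk⟩ := hc
    refine ⟨(I k).subtype ∘ₗ DirectSum.component R ι (fun i => I i) k ∘ₗ e.toLinearMap ∘ₗ
      (pureClosure (R ∙ c)).subtype, (injective_iff_map_eq_zero _).2 ?_⟩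
    rintro ⟨x, hx⟩ h
    have h0 : (e x k : R) = 0 := h
    have := smul_eq_coord_smul_of_mem_pureClosure e hx k
    rw [h0, zero_smul] at this
    exact Subtype.ext ((smul_eq_zero.1 this).resolve_left hk)
  · push Not at hc
    have hc0 : c = 0 := e.injective (DFinsupp.ext fun i => Subtype.ext (by simpa using hc i))
    refine ⟨0, fun x y _ => Subtype.ext ?_⟩
    have hz : ∀ z : pureClosure (R ∙ c), (z : G) = 0 := by
      rintro ⟨z, r, hr, hz⟩
      rw [hc0, Submodule.span_zero_singleton, Submodule.mem_bot] at hz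
      exact (smul_eq_zero.1 hz).resolve_left hr
    rw [hz, hz]

/-- Over an `h`-local Prüfer domain a pure submodule `J` of rank one in a direct sum of ideals is a
direct summand. The scalars `a` for which `a • id_J` extends to a map into `J` form an ideal; it
lies in no maximal ideal `m`, because at `m` one of the finitely many coordinates of a generator
dominates all others, and the projection to that coordinate, rescaled, lands in `J`. -/
theorem exists_projection_pureClosure_singleton (hP : IsPruferDomain R) (hL : IsHLocalDomain R)
    (e : G ≃ₗ[R] ⨁ i, ↥(I i)) (c : G) :
    ∃ φ : G →ₗ[R] G, (∀ x, φ x ∈ pureClosure (R ∙ c)) ∧ ∀ x ∈ pureClosure (R ∙ c), φ x = x := by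
  classical
  by_cases hc : c = 0
  · refine ⟨0, fun x => zero_mem _, ?_⟩
    rintro z ⟨r, hr, hz⟩
    rw [hc, Submodule.span_zero_singleton, Submodule.mem_bot] at hz
    exact ((smul_eq_zero.1 hz).resolve_left hr).symm
  let 𝔞 : Ideal R :=
    { carrier := {a | ∃ φ : G →ₗ[R] G, (∀ x, φ x ∈ pureClosure (R ∙ c)) ∧
        ∀ x ∈ pureClosure (R ∙ c), φ x = a • x}
      zero_mem' := ⟨0, fun _ => zero_mem _, by simp⟩
      add_mem' := by
        rintro a b ⟨φ, h₁, h₂⟩ ⟨ψ, h₃, h₄⟩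
        exact ⟨φ + ψ, fun x => add_mem (h₁ x) (h₃ x), fun x hx => by
          rw [LinearMap.add_apply, h₂ x hx, h₄ x hx, add_smul]⟩
      smul_mem' := by
        rintro r a ⟨φ, h₁, h₂⟩
        exact ⟨r • φ, fun x => Submodule.smul_mem _ r (h₁ x), fun x hx => by
          rw [LinearMap.smul_apply, h₂ x hx, smul_assoc]⟩ }
  suffices h : 𝔞 = ⊤ by
    obtain ⟨φ, h₁, h₂⟩ := (Ideal.eq_top_iff_one 𝔞).1 h
    exact ⟨φ, h₁, fun x hx => by simpa using h₂ x hx⟩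
  by_contra htop
  obtain ⟨m, hm, h𝔞m⟩ := Ideal.exists_le_maximal 𝔞 htop
  have := hm.isPrime
  let s := DFinsupp.support (e c)
  have hs : ∀ i, i ∈ s ↔ (e c i : R) ≠ 0 := fun i => by simp [s]
  have hne : s.Nonempty := by
    rw [Finset.nonempty_iff_ne_empty]
    intro h
    exact hc (e.injective (by simpa [s] using h))
  obtain ⟨k, hk, hmin⟩ := hP.exists_fracLEAt_forall m I (fun i => (e c i : R)) s hne
    fun i hi => (hs i).1 hi
  have hck := (hs k).1 hk
  have hex : ∀ i, ∃ t ∉ m, i ∈ s → ∀ z ∈ I k, ∃ w ∈ I i, t * z * e c i = e c k * w := fun i => by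
    by_cases hi : i ∈ s
    · obtain ⟨t, ht, h⟩ := hL.exists_uniform_of_fracLEAt hm hck ((hs i).1 hi) (e c i).2 (hmin i hi)
      exact ⟨t, ht, fun _ => h⟩
    · exact ⟨1, (Ideal.ne_top_iff_one m).1 hm.ne_top, fun h => (hi h).elim⟩
  choose t htm ht using hex
  set T := ∏ i ∈ s, t i with hT
  have hTm : T ∉ m := fun h => by
    obtain ⟨i, -, hi⟩ := Ideal.IsPrime.prod_mem_iff.1 h
    exact htm i hi
  refine hTm (h𝔞m ?_)
  -- `ψ x = T x_k c` is divisible by `c_k`.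
  let π : G →ₗ[R] R := (I k).subtype ∘ₗ DirectSum.component R ι (fun i => I i) k ∘ₗ e.toLinearMap
  have hπ : ∀ x, π x = e x k := fun x => rfl
  obtain ⟨φ, hφ⟩ := LinearMap.exists_smul_eq hck (T • LinearMap.toSpanSingleton R G c ∘ₗ π) <| by
    intro x
    suffices h : (T * π x) • c ∈ LinearMap.range (LinearMap.lsmul R G (e c k : R)) by
      obtain ⟨w, hw⟩ := h
      exact ⟨w, by simpa [mul_smul] using hw⟩
    have hsum : c = ∑ i ∈ s, e.symm (DirectSum.lof R ι (fun i => I i) i (e c i)) := by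
      rw [← map_sum, ← LinearEquiv.symm_apply_eq, LinearEquiv.symm_symm]
      exact (DirectSum.sum_support_of (e c)).symm
    have hsmul := congrArg ((T * π x) • ·) hsum
    simp only [Finset.smul_sum] at hsmul
    rw [hsmul]
    refine Submodule.sum_mem _ fun i hi => ?_
    obtain ⟨w, hw, h⟩ := ht i hi (π x) (e x k).2
    obtain ⟨y, hy⟩ := Finset.dvd_prod_of_mem t hi
    refine ⟨e.symm (DirectSum.lof R ι (fun i => I i) i (y • ⟨w, hw⟩)), ?_⟩
    rw [LinearMap.lsmul_apply, ← map_smul, ← map_smul, ← map_smul, ← map_smul]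
    congr 2
    refine Subtype.ext ?_
    simp only [SetLike.val_smul, smul_eq_mul]
    rw [hT, hy]
    linear_combination -y * h
  refine ⟨φ, fun x => ⟨_, hck, ?_⟩, fun x hx => smul_right_injective G hck ?_⟩
  · rw [hφ]
    exact Submodule.mem_span_singleton.2 ⟨T * π x, by simp [mul_smul]⟩
  · simp only [hφ]
    rw [smul_comm, smul_eq_coord_smul_of_mem_pureClosure e hx k]
    simp [hπ]

end RankOne

/-! ### Extending a submodule by pure closures of single elements -/

section Step

variable {R : Type u} {M : Type v} [CommRing R] [IsDomain R] [AddCommGroup M] [Module R M]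
  [Module.IsTorsionFree R M]

theorem pureClosure_singleton_isSummand (hP : IsPruferDomain R) (hL : IsHLocalDomain R)
    {N : Submodule R M} (hN : IsRelDivisible N) {ι : Type*} {I : ι → Ideal R}
    (e : N ≃ₗ[R] ⨁ i, ↥(I i)) {c : M} (hc : c ∈ N) :
    (∃ D, Disjoint (pureClosure (R ∙ c)) D ∧ pureClosure (R ∙ c) ⊔ D = N) ∧
      ∃ f : pureClosure (R ∙ c) →ₗ[R] R, Function.Injective f := by
  have hJ : pureClosure (R ∙ c) = (pureClosure (R ∙ (⟨c, hc⟩ : N))).map N.subtype := by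
    apply le_antisymm
    · intro x hx
      have hxN : x ∈ N := pureClosure_le hN ((Submodule.span_singleton_le_iff_mem _ _).2 hc) hx
      obtain ⟨r, hr, hx⟩ := hx
      obtain ⟨a, ha⟩ := Submodule.mem_span_singleton.1 hx
      exact ⟨⟨x, hxN⟩, ⟨r, hr, Submodule.mem_span_singleton.2 ⟨a, Subtype.ext ha⟩⟩, rfl⟩
    · rintro _ ⟨x, ⟨r, hr, hx⟩, rfl⟩
      obtain ⟨a, ha⟩ := Submodule.mem_span_singleton.1 hx
      exact ⟨r, hr, Submodule.mem_span_singleton.2 ⟨a, congrArg Subtype.val ha⟩⟩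
  rw [hJ]
  constructor
  · obtain ⟨φ, h₁, h₂⟩ := exists_projection_pureClosure_singleton hP hL e ⟨c, hc⟩
    refine ⟨(LinearMap.ker φ).map N.subtype, ?_, ?_⟩
    · refine Submodule.disjoint_map N.injective_subtype ?_
      rw [Submodule.disjoint_def]
      intro x hx hx'
      rw [← h₂ x hx]
      exact hx'
    · rw [← Submodule.map_sup]
      convert N.map_subtype_top
      rw [eq_top_iff]
      intro x _
      refine Submodule.mem_sup.2 ⟨φ x, h₁ x, x - φ x, ?_, by abel⟩
      rw [LinearMap.mem_ker, map_sub, h₂ _ (h₁ x), sub_self]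
  · obtain ⟨f, hf⟩ := exists_injective_pureClosure_singleton e ⟨c, hc⟩
    exact ⟨f ∘ₗ (Submodule.equivMapOfInjective N.subtype N.injective_subtype _).symm.toLinearMap,
      hf.comp (LinearEquiv.injective _)⟩

theorem IsRelDivisible.of_disjoint_sup {B C N : Submodule R M} (hN : IsRelDivisible N)
    (hd : Disjoint B C) (hs : B ⊔ C = N) : IsRelDivisible B := by
  intro r hr x hx
  have hxN : x ∈ B ⊔ C := hs ▸ hN r hr x (hs ▸ (le_sup_left : B ≤ B ⊔ C) hx)
  obtain ⟨b, hb, c, hc, rfl⟩ := Submodule.mem_sup.1 hxN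
  have h : r • c ∈ B := by
    have := B.sub_mem hx (B.smul_mem r hb)
    simpa [smul_add] using this
  have h0 := Submodule.disjoint_def.1 hd _ h (C.smul_mem r hc)
  rw [(smul_eq_zero.1 h0).resolve_left hr, add_zero]
  exact hb

/-- Adjoining one element to a direct summand `B` of a direct sum of ideals `N` and closing up
purely adds one further direct summand, isomorphic to an ideal. -/
theorem exists_summand_adjoin (hP : IsPruferDomain R) (hL : IsHLocalDomain R)
    {N : Submodule R M} (hN : IsRelDivisible N) {ι : Type*} {I : ι → Ideal R}
    (e : N ≃ₗ[R] ⨁ i, ↥(I i)) {B : Submodule R M} (hB : ∃ C, Disjoint B C ∧ B ⊔ C = N)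
    {x : M} (hx : x ∈ N) :
    ∃ J : Submodule R M, (∃ f : J →ₗ[R] R, Function.Injective f) ∧ Disjoint B J ∧
      pureClosure (B ⊔ R ∙ x) = B ⊔ J ∧
      ∃ C, Disjoint (pureClosure (B ⊔ R ∙ x)) C ∧ pureClosure (B ⊔ R ∙ x) ⊔ C = N := by
  obtain ⟨C, hd, hs⟩ := hB
  obtain ⟨b, hb, c, hc, rfl⟩ := Submodule.mem_sup.1 (hs ▸ hx)
  have hBN : B ≤ N := hs ▸ le_sup_left
  have hCN : C ≤ N := hs ▸ le_sup_right
  obtain ⟨⟨D, hJD, hJDN⟩, hf⟩ := pureClosure_singleton_isSummand hP hL hN e (hCN hc)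
  set J := pureClosure (R ∙ c) with hJ
  have hCrd : IsRelDivisible C := hN.of_disjoint_sup hd.symm (by rw [sup_comm, hs])
  have hJC : J ≤ C := pureClosure_le hCrd ((Submodule.span_singleton_le_iff_mem _ _).2 hc)
  have hJDC : J ⊔ D ⊓ C = C := by
    rw [← sup_inf_assoc_of_le D hJC, hJDN, inf_eq_right.2 hCN]
  have hJDd : Disjoint J (D ⊓ C) := hJD.mono_right inf_le_left
  have hd' : Disjoint (B ⊔ J) (D ⊓ C) := by
    refine Disjoint.disjoint_sup_left_of_disjoint_sup_right hJDd ?_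
    rwa [hJDC]
  have hs' : B ⊔ J ⊔ D ⊓ C = N := by rw [sup_assoc, hJDC, hs]
  have hcl : pureClosure (B ⊔ R ∙ (b + c)) = B ⊔ J := by
    have hmem : b + c ∈ pureClosure (B ⊔ R ∙ (b + c)) :=
      le_pureClosure _ ((le_sup_right : _ ≤ B ⊔ R ∙ (b + c)) (Submodule.mem_span_singleton_self _))
    have hBle : B ≤ pureClosure (B ⊔ R ∙ (b + c)) := le_sup_left.trans (le_pureClosure _)
    apply le_antisymm
    · refine pureClosure_le (hN.of_disjoint_sup hd' hs') (sup_le le_sup_left ?_)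
      rw [Submodule.span_singleton_le_iff_mem]
      refine Submodule.add_mem_sup hb (le_pureClosure _ (Submodule.mem_span_singleton_self _))
    · refine sup_le hBle (pureClosure_le (isRelDivisible_pureClosure _) ?_)
      rw [Submodule.span_singleton_le_iff_mem]
      simpa using sub_mem hmem (hBle hb)
  exact ⟨J, hf, hd.mono_right hJC, hcl, D ⊓ C, by rwa [hcl], by rw [hcl, hs']⟩

/-- `B` is well placed in the chain `A`: for all large `n`, `B ⊓ A n` is a direct summand of `A n`,
and `B ⊔ A n` is relatively divisible. -/
structure IsWellPlaced (A : ℕ → Submodule R M) (B : Submodule R M) : Prop where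
  isRelDivisible : IsRelDivisible B
  eventually : ∃ n₀, ∀ n ≥ n₀,
    (∃ C, Disjoint (B ⊓ A n) C ∧ B ⊓ A n ⊔ C = A n) ∧ IsRelDivisible (B ⊔ A n)

theorem IsWellPlaced.adjoin (hP : IsPruferDomain R) (hL : IsHLocalDomain R)
    {A : ℕ → Submodule R M} (hA_mono : Monotone A) (hA_union : ∀ x, ∃ n, x ∈ A n)
    (hA : ∀ n, IsRelDivisible (A n)) {ι : ℕ → Type*} {I : ∀ n, ι n → Ideal R}
    (e : ∀ n, A n ≃ₗ[R] ⨁ i, ↥(I n i)) {B : Submodule R M} (hB : IsWellPlaced A B) (x : M) :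
    IsWellPlaced A (pureClosure (B ⊔ R ∙ x)) ∧
    ∃ J : Submodule R M, (∃ f : J →ₗ[R] R, Function.Injective f) ∧ Disjoint B J ∧
      pureClosure (B ⊔ R ∙ x) = B ⊔ J := by
  obtain ⟨n₀, hn₀⟩ := hB.eventually
  obtain ⟨n₁, hn₁⟩ := hA_union x
  have hBle : B ≤ pureClosure (B ⊔ R ∙ x) := le_sup_left.trans (le_pureClosure _)
  have hle : ∀ n ≥ max n₀ n₁, pureClosure (B ⊔ R ∙ x) ≤ B ⊔ A n := fun n hn => by
    refine pureClosure_le (hn₀ n (le_of_max_le_left hn)).2 (sup_le le_sup_left ?_)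
    rw [Submodule.span_singleton_le_iff_mem]
    exact (le_sup_right : A n ≤ _) (hA_mono (le_of_max_le_right hn) hn₁)
  have hinf : ∀ n ≥ max n₀ n₁, pureClosure (B ⊔ R ∙ x) ⊓ A n = pureClosure (B ⊓ A n ⊔ R ∙ x) := by
    intro n hn
    have hxn : x ∈ A n := hA_mono (le_of_max_le_right hn) hn₁
    apply le_antisymm
    · rintro y ⟨⟨r, hr, hy⟩, hyn⟩
      obtain ⟨b, hb, z, hz, h⟩ := Submodule.mem_sup.1 hy
      refine ⟨r, hr, h ▸ Submodule.add_mem_sup ⟨hb, ?_⟩ hz⟩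
      have hzn : z ∈ A n := (Submodule.span_singleton_le_iff_mem _ _).2 hxn hz
      rw [eq_sub_of_add_eq h]
      exact sub_mem ((A n).smul_mem r hyn) hzn
    · refine le_inf (pureClosure_mono (sup_le_sup_right inf_le_left _)) (pureClosure_le (hA n) ?_)
      exact sup_le inf_le_right ((Submodule.span_singleton_le_iff_mem _ _).2 hxn)
  have hstep := fun n (hn : n ≥ max n₀ n₁) =>
    exists_summand_adjoin hP hL (hA n) (e n) (hn₀ n (le_of_max_le_left hn)).1
      (hA_mono (le_of_max_le_right hn) hn₁ : x ∈ A n)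
  refine ⟨⟨isRelDivisible_pureClosure _, max n₀ n₁, fun n hn => ⟨?_, ?_⟩⟩, ?_⟩
  · obtain ⟨J, -, -, -, h⟩ := hstep n hn
    rwa [hinf n hn]
  · have : pureClosure (B ⊔ R ∙ x) ⊔ A n = B ⊔ A n :=
      le_antisymm (sup_le (hle n hn) le_sup_right) (sup_le_sup_right hBle _)
    rw [this]
    exact (hn₀ n (le_of_max_le_left hn)).2
  · obtain ⟨J, hf, hd, hcl, -⟩ := hstep _ le_rfl
    set n := max n₀ n₁ with hn
    rw [← hinf n le_rfl] at hcl
    have hJ : J ≤ pureClosure (B ⊔ R ∙ x) ⊓ A n := hcl ▸ le_sup_right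
    refine ⟨J, hf, ?_, le_antisymm ?_ (sup_le hBle (hJ.trans inf_le_left))⟩
    · rw [Submodule.disjoint_def]
      exact fun y hy hy' => Submodule.disjoint_def.1 hd y ⟨hy, (hJ hy').2⟩ hy'
    · calc pureClosure (B ⊔ R ∙ x) = (B ⊔ A n) ⊓ pureClosure (B ⊔ R ∙ x) :=
            (inf_eq_right.2 (hle n le_rfl)).symm
        _ = B ⊔ A n ⊓ pureClosure (B ⊔ R ∙ x) := sup_inf_assoc_of_le _ hBle
        _ = B ⊔ (B ⊓ A n ⊔ J) := by rw [inf_comm, hcl]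
        _ ≤ B ⊔ J := sup_le le_sup_left (sup_le (inf_le_left.trans le_sup_left) le_sup_right)

/-- A pure extension of countable rank of a well-placed submodule is the direct sum of that
submodule and of submodules isomorphic to ideals; a decomposition `S` of the submodule is thereby
enlarged to a decomposition `S'` of the extension. -/
theorem IsWellPlaced.exists_sSupIndep (hP : IsPruferDomain R) (hL : IsHLocalDomain R)
    {A : ℕ → Submodule R M} (hA_mono : Monotone A) (hA_union : ∀ x, ∃ n, x ∈ A n)
    (hA : ∀ n, IsRelDivisible (A n)) {ι : ℕ → Type*} {I : ∀ n, ι n → Ideal R}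
    (e : ∀ n, A n ≃ₗ[R] ⨁ i, ↥(I n i)) {S : Set (Submodule R M)} (hS : sSupIndep S)
    (hSI : ∀ J ∈ S, ∃ f : J →ₗ[R] R, Function.Injective f) (hB : IsWellPlaced A (sSup S))
    (x : ℕ → M) :
    ∃ S' : Set (Submodule R M), S ⊆ S' ∧ sSupIndep S' ∧
      (∀ J ∈ S', ∃ f : J →ₗ[R] R, Function.Injective f) ∧
      sSup S' = pureClosure (sSup S ⊔ Submodule.span R (Set.range x)) := by
  let B : ℕ → Submodule R M := fun n => Nat.rec (sSup S) (fun k P => pureClosure (P ⊔ R ∙ x k)) n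
  have hB0 : B 0 = sSup S := rfl
  have hBs : ∀ k, B (k + 1) = pureClosure (B k ⊔ R ∙ x k) := fun _ => rfl
  have hBw : ∀ k, IsWellPlaced A (B k) := fun k => by
    induction k with
    | zero => exact hB
    | succ k ih => exact (ih.adjoin hP hL hA_mono hA_union hA e (x k)).1
  choose J hJI hJd hJ using fun k => ((hBw k).adjoin hP hL hA_mono hA_union hA e (x k)).2
  let T : ℕ → Set (Submodule R M) := fun n => Nat.rec S (fun k P => insert (J k) P) n
  have hTs : ∀ k, T (k + 1) = insert (J k) (T k) := fun _ => rfl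
  have hT : ∀ k, sSup (T k) = B k ∧ sSupIndep (T k) ∧
      ∀ J ∈ T k, ∃ f : J →ₗ[R] R, Function.Injective f := fun k => by
    induction k with
    | zero => exact ⟨rfl, hS, hSI⟩
    | succ k ih =>
      obtain ⟨h₁, h₂, h₃⟩ := ih
      refine ⟨?_, ?_, ?_⟩
      · rw [hTs, sSup_insert, h₁, hBs, hJ, sup_comm]
      · rw [hTs]
        intro a ha
        by_cases haJ : a = J k
        · subst haJ
          refine (hJd k).symm.mono_right ?_
          rw [← h₁]
          exact sSup_le_sSup fun y hy => hy.1.resolve_left hy.2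
        · have haT : a ∈ T k := ha.resolve_left haJ
          have hle : sSup (insert (J k) (T k) \ {a}) ≤ sSup (T k \ {a}) ⊔ J k := by
            refine sSup_le fun y hy => ?_
            rcases hy.1 with rfl | hyT
            · exact le_sup_right
            · exact le_sup_of_le_left (le_sSup ⟨hyT, hy.2⟩)
          refine Disjoint.mono_right hle (Disjoint.disjoint_sup_right_of_disjoint_sup_left
            (h₂ haT) ((hJd k).mono_left ?_))
          rw [← h₁]
          exact sup_le (le_sSup haT) (sSup_le_sSup Set.sdiff_subset)
      · rw [hTs]
        rintro a (rfl | ha)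
        · exact hJI k
        · exact h₃ a ha
  have hTmono : Monotone T := monotone_nat_of_le_succ fun k => hTs k ▸ Set.subset_insert _ _
  have hBmono : Monotone B := monotone_nat_of_le_succ fun k =>
    hBs k ▸ le_sup_left.trans (le_pureClosure _)
  refine ⟨⋃ k, T k, Set.subset_iUnion T 0,
    sSupIndep_iUnion_of_directed hTmono.directed_le fun k => (hT k).2.1, fun a ha => ?_, ?_⟩
  · obtain ⟨k, hk⟩ := Set.mem_iUnion.1 ha
    exact (hT k).2.2 a hk
  · rw [sSup_iUnion]
    simp only [(hT _).1]
    apply le_antisymm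
    · refine iSup_le fun k => ?_
      induction k with
      | zero => exact le_sup_left.trans (le_pureClosure _)
      | succ k ih =>
        rw [hBs]
        refine pureClosure_le (isRelDivisible_pureClosure _) (sup_le ih ?_)
        refine le_trans ?_ (le_sup_right.trans (le_pureClosure _))
        exact Submodule.span_mono (by simp)
    · have hrd : IsRelDivisible (⨆ k, B k) := fun r hr y hy => by
        rw [Submodule.mem_iSup_of_directed _ hBmono.directed_le] at hy ⊢
        obtain ⟨k, hk⟩ := hy
        exact ⟨k, (hBw k).isRelDivisible r hr y hk⟩
      refine pureClosure_le hrd (sup_le (le_iSup B 0) (Submodule.span_le.2 ?_))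
      rintro _ ⟨k, rfl⟩
      refine (le_iSup B (k + 1)) ?_
      rw [hBs]
      exact le_pureClosure _ ((le_sup_right : _ ≤ B k ⊔ R ∙ x k)
        (Submodule.mem_span_singleton_self _))

end Step

/-! ### Countable generating sets up to torsion -/

section Countable

variable {R : Type u} {M : Type v} [CommRing R] [IsDomain R] [AddCommGroup M] [Module R M]

/-- If `Q` has countable rank over `B`, witnessed by a countable set `S` of arbitrary elements of
`M`, then there is also a countable witness inside `Q`. -/
theorem exists_countable_subset_le_pureClosure {B Q : Submodule R M} {S : Set M}
    (hS : S.Countable) (hQ : Q ≤ pureClosure (B ⊔ Submodule.span R S)) :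
    ∃ T : Set M, T.Countable ∧ T ⊆ Q ∧ Q ≤ pureClosure (B ⊔ Submodule.span R T) := by
  obtain ⟨s, hs, hmax⟩ := exists_maximal_linearIndepOn R (fun q : Q => B.mkQ q)
  refine ⟨Subtype.val '' s, Set.Countable.image ?_ _, ?_, ?_⟩
  · -- Multiples of the independent family lie in the span of the image of `S`.
    let U : Submodule R (M ⧸ B) := Submodule.span R (B.mkQ '' S)
    have hr : ∀ q : s, ∃ r : R, r ≠ 0 ∧ r • B.mkQ (q : Q) ∈ U := by
      intro q
      obtain ⟨r, hr, h⟩ := hQ (q : Q).2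
      obtain ⟨b, hb, t, ht, h⟩ := Submodule.mem_sup.1 h
      refine ⟨r, hr, ?_⟩
      rw [← map_smul, ← h, map_add, (B.mkQ_apply b).trans ((Submodule.Quotient.mk_eq_zero B).2 hb),
        zero_add]
      have hmem := Submodule.mem_map_of_mem (f := B.mkQ) ht
      rwa [Submodule.map_span] at hmem
    choose r hr0 hrU using hr
    have hli : LinearIndependent R (fun q : s => (⟨r q • B.mkQ (q : Q), hrU q⟩ : U)) := by
      refine LinearIndependent.of_comp U.subtype ?_
      rw [linearIndependent_iff']
      intro F g hg q hq
      have hg' : ∑ q ∈ F, (g q * r q) • B.mkQ ((q : Q) : M) = 0 := by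
        rw [← hg]
        exact Finset.sum_congr rfl fun q _ => mul_smul _ _ _
      exact (mul_eq_zero.1 (linearIndependent_iff'.1 hs F _ hg' q hq)).resolve_right (hr0 q)
    have h₁ := hli.cardinal_le_rank
    have h₂ : Module.rank R U ≤ Cardinal.aleph0 :=
      (rank_span_le _).trans (Cardinal.le_aleph0_iff_set_countable.2 (hS.image _))
    exact Cardinal.le_aleph0_iff_set_countable.1 (h₁.trans h₂)
  · rintro _ ⟨q, -, rfl⟩
    exact q.2
  · intro x hx
    by_cases hxs : (⟨x, hx⟩ : Q) ∈ s
    · exact le_pureClosure _ ((le_sup_right : _ ≤ B ⊔ _) (Submodule.subset_span ⟨_, hxs, rfl⟩))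
    · obtain ⟨a, ha, h⟩ := hmax _ hxs
      refine ⟨a, ha, ?_⟩
      have him : (fun q : Q => B.mkQ q) '' s = B.mkQ '' (Subtype.val '' s) :=
        (Set.image_image _ _ _).symm
      rw [him, ← Submodule.map_span, ← map_smul] at h
      obtain ⟨t, ht, h⟩ := h
      have hb := (Submodule.Quotient.eq B).1 h.symm
      rw [← sub_add_cancel (a • x) t]
      exact Submodule.add_mem_sup hb ht

theorem mem_pureClosure_sup_span_iUnion {B : Submodule R M} {S : ℕ → Set M} (hS : Monotone S)
    {x : M} : x ∈ pureClosure (B ⊔ Submodule.span R (⋃ k, S k)) ↔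
      ∃ k, x ∈ pureClosure (B ⊔ Submodule.span R (S k)) := by
  constructor
  · rintro ⟨r, hr, h⟩
    obtain ⟨b, hb, t, ht, h⟩ := Submodule.mem_sup.1 h
    have hmono : Monotone fun k => Submodule.span R (S k) := fun _ _ h => Submodule.span_mono (hS h)
    rw [Submodule.span_iUnion, Submodule.mem_iSup_of_directed _ hmono.directed_le] at ht
    obtain ⟨k, hk⟩ := ht
    exact ⟨k, r, hr, h ▸ Submodule.add_mem_sup hb hk⟩
  · rintro ⟨k, hk⟩
    exact pureClosure_mono (sup_le_sup_left (Submodule.span_mono (Set.subset_iUnion S k)) _) hk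

end Countable

/-! ### Submodules adapted to the chain -/

section Adapted

variable {R : Type u} {M : Type v} [CommRing R] [AddCommGroup M] [Module R M]

/-- The preimages in `M` of a `G(ℵ₀)`-family of pure submodules of `P ⧸ N`. Only the properties
used below are recorded. -/
structure IsStepFamily (N P : Submodule R M) (F : Set (Submodule R M)) : Prop where
  le_of_mem : ∀ D ∈ F, D ≤ P
  ge_of_mem : ∀ D ∈ F, N ≤ D
  isRelDivisible : ∀ D ∈ F, IsRelDivisible D
  bot_mem : N ∈ F
  sSup_mem : ∀ c ⊆ F, c.Nonempty → IsChain (· ≤ ·) c → sSup c ∈ F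
  exists_extension : ∀ D₀ ∈ F, ∀ H : Set M, H.Countable → H ⊆ P →
    ∃ D ∈ F, D₀ ≤ D ∧ H ⊆ D ∧ ∃ S : Set M, S.Countable ∧ D = D₀ ⊔ Submodule.span R S

theorem IsGAlephZeroFamily.exists_isStepFamily [IsDomain R] {N P : Submodule R M} (hNP : N ≤ P)
    (hN : IsRelDivisible N) (hP : IsRelDivisible P) {C : Set (Submodule R (P ⧸ N.submoduleOf P))}
    (hC : IsGAlephZeroFamily C) (hpure : ∀ D ∈ C, IsPureSubmodule D) :
    ∃ F, IsStepFamily N P F := by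
  have htf : Module.IsTorsionFree R (P ⧸ N.submoduleOf P) := by
    rw [Module.isTorsionFree_iff_smul_eq_zero]
    intro r x
    obtain ⟨x, rfl⟩ := Submodule.mkQ_surjective _ x
    intro h
    by_cases hr : r = 0
    · exact .inl hr
    · rw [← map_smul] at h
      exact .inr ((Submodule.Quotient.mk_eq_zero _).2
        (hN r hr x ((Submodule.Quotient.mk_eq_zero (N.submoduleOf P)).1 h)))
  set q := (N.submoduleOf P).mkQ with hq
  have hqs : Function.Surjective q := Submodule.mkQ_surjective _
  let Φ : Submodule R (P ⧸ N.submoduleOf P) → Submodule R M := fun D => (D.comap q).map P.subtype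
  have hΦ : ∀ D x, x ∈ Φ D ↔ ∃ h : x ∈ P, q ⟨x, h⟩ ∈ D := fun D x => by simp [Φ]
  have hq0 : ∀ x : P, q x = 0 ↔ (x : M) ∈ N := fun x =>
    Submodule.Quotient.mk_eq_zero (N.submoduleOf P)
  have hΦle : ∀ D E, Φ D ≤ Φ E ↔ D ≤ E := fun D E => by
    rw [Submodule.map_le_map_iff_of_injective P.injective_subtype,
      Submodule.comap_le_comap_iff_of_surjective hqs]
  refine ⟨Φ '' C, ?_, ?_, ?_, ?_, ?_, ?_⟩
  · rintro _ ⟨D, -, rfl⟩ x hx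
    exact ((hΦ D x).1 hx).1
  · rintro _ ⟨D, -, rfl⟩ x hx
    refine (hΦ D x).2 ⟨hNP hx, ?_⟩
    rw [(hq0 ⟨x, hNP hx⟩).2 hx]
    exact D.zero_mem
  · rintro _ ⟨D, hD, rfl⟩ r hr x hx
    obtain ⟨h, hx⟩ := (hΦ D _).1 hx
    have hxP := hP r hr x h
    exact (hΦ D x).2 ⟨hxP, (hpure D hD).isRelDivisible r hr _ hx⟩
  · refine ⟨⊥, hC.bot_mem, ?_⟩
    ext x
    rw [hΦ]
    constructor
    · rintro ⟨h, hx⟩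
      exact (hq0 _).1 hx
    · intro hx
      exact ⟨hNP hx, (hq0 ⟨x, hNP hx⟩).2 hx⟩
  · intro c hc hne hch
    let c' := C ∩ Φ ⁻¹' c
    have hcc : c = Φ '' c' := by
      ext D
      constructor
      · intro hD
        obtain ⟨E, hE, rfl⟩ := hc hD
        exact ⟨E, ⟨hE, hD⟩, rfl⟩
      · rintro ⟨E, hE, rfl⟩
        exact hE.2
    have hne' : c'.Nonempty := by
      rw [hcc] at hne
      exact hne.of_image
    have hch' : IsChain (· ≤ ·) c' := fun D hD E hE _ => by
      simpa only [hΦle] using hch.total hD.2 hE.2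
    refine ⟨sSup c', hC.sSup_mem c' Set.inter_subset_left hne' hch', ?_⟩
    ext x
    rw [hΦ, Submodule.mem_sSup_of_directed hne hch.directedOn]
    constructor
    · rintro ⟨h, hx⟩
      obtain ⟨D, hD, hx⟩ := (Submodule.mem_sSup_of_directed hne' hch'.directedOn).1 hx
      exact ⟨Φ D, hD.2, (hΦ D x).2 ⟨h, hx⟩⟩
    · rintro ⟨D, hD, hx⟩
      rw [hcc] at hD
      obtain ⟨E, hE, rfl⟩ := hD
      obtain ⟨h, hx⟩ := (hΦ E x).1 hx
      exact ⟨h, (le_sSup hE : E ≤ sSup c') hx⟩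
  · rintro _ ⟨D₀, hD₀, rfl⟩ H hH hHP
    obtain ⟨D, hD, hle, hHD, S, hS, hspan⟩ := hC.exists_countable_extension D₀ hD₀
      (q '' (Subtype.val ⁻¹' H)) ((hH.preimage Subtype.val_injective).image _)
    have hsurj : Function.Surjective (D₀.mkQ ∘ₗ q) := (Submodule.mkQ_surjective _).comp hqs
    let g := Function.surjInv hsurj
    have hg : ∀ s, D₀.mkQ (q (g s)) = s := Function.surjInv_eq hsurj
    have hgS : S = (D₀.mkQ ∘ₗ q) '' (g '' S) := by
      rw [Set.image_image]
      simp [hg]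
    refine ⟨Φ D, ⟨D, hD, rfl⟩, (hΦle _ _).2 hle, fun x hx => (hΦ D x).2 ⟨hHP hx, hHD ⟨_, hx, rfl⟩⟩,
      P.subtype '' (g '' S), (hS.image _).image _, le_antisymm ?_ (sup_le ((hΦle _ _).2 hle) ?_)⟩
    · intro x hx
      obtain ⟨h, hx⟩ := (hΦ D x).1 hx
      have hx' : D₀.mkQ (q ⟨x, h⟩) ∈ Submodule.span R S := hspan ▸ ⟨_, hx, rfl⟩
      rw [hgS, ← Submodule.map_span] at hx'
      obtain ⟨t, ht, htx⟩ := hx'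
      have hsub : q (⟨x, h⟩ - t) ∈ D₀ := by
        rw [map_sub]
        exact (Submodule.Quotient.eq D₀).1 htx.symm
      rw [← Submodule.map_span, ← sub_add_cancel x (t : M)]
      exact Submodule.add_mem_sup ((hΦ D₀ _).2 ⟨P.sub_mem h t.2, hsub⟩) ⟨t, ht, rfl⟩
    · rw [Submodule.span_le]
      rintro _ ⟨_, ⟨s, hs, rfl⟩, rfl⟩
      refine (hΦ D _).2 ⟨(g s).2, ?_⟩
      have : D₀.mkQ (q (g s)) ∈ D.map D₀.mkQ := by
        rw [hg, ← hspan]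
        exact Submodule.subset_span hs
      obtain ⟨d, hd, h⟩ := this
      have := D.add_mem (hle ((Submodule.Quotient.eq D₀).1 h.symm)) hd
      simpa using this

variable {A : ℕ → Submodule R M} {ι : ℕ → Type*} {I : ∀ n, ι n → Ideal R}

open Classical in
/-- The canonical copy of the ideal `I n i` inside `A n ≤ M`. -/
noncomputable def summandIncl (e : ∀ n, A n ≃ₗ[R] ⨁ i, ↥(I n i)) (n : ℕ) (i : ι n) :
    I n i →ₗ[R] M :=
  (A n).subtype ∘ₗ (e n).symm.toLinearMap ∘ₗ DirectSum.lof R (ι n) (fun i => I n i) i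

theorem summandIncl_mem (e : ∀ n, A n ≃ₗ[R] ⨁ i, ↥(I n i)) (n : ℕ) (i : ι n) (z : I n i) :
    summandIncl e n i z ∈ A n :=
  Subtype.prop _

open Classical in
theorem eq_sum_summandIncl (e : ∀ n, A n ≃ₗ[R] ⨁ i, ↥(I n i)) (n : ℕ) (x : A n) :
    (x : M) = ∑ i ∈ DFinsupp.support (e n x), summandIncl e n i (e n x i) := by
  have h : x = ∑ i ∈ DFinsupp.support (e n x),
      (e n).symm (DirectSum.lof R (ι n) (fun i => I n i) i (e n x i)) := by
    rw [← map_sum, ← LinearEquiv.symm_apply_eq, LinearEquiv.symm_symm]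
    exact (DirectSum.sum_support_of (e n x)).symm
  conv_lhs => rw [h, Submodule.coe_sum]
  rfl

/-- `B` is adapted to the chain `A`: it meets each `A n` in the sum of a subfamily of the given
decomposition of `A n` (in the equivalent form: if some element of `B ⊓ A n` has a nonzero `i`-th
coordinate, then the whole `i`-th summand is in `B`), and its trace on `A (n + 1) ⧸ A n` belongs to
the given family. Both conditions are preserved by unions of chains. -/
structure IsAdapted (e : ∀ n, A n ≃ₗ[R] ⨁ i, ↥(I n i)) (F : ℕ → Set (Submodule R M))
    (B : Submodule R M) : Prop where
  summand_mem : ∀ (n : ℕ) (x : A n), (x : M) ∈ B → ∀ i, e n x i ≠ 0 →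
    ∀ z, summandIncl e n i z ∈ B
  inf_sup_mem : ∀ n, B ⊓ A (n + 1) ⊔ A n ∈ F n

variable {e : ∀ n, A n ≃ₗ[R] ⨁ i, ↥(I n i)} {F : ℕ → Set (Submodule R M)}

theorem isAdapted_bot (hF : ∀ n, IsStepFamily (A n) (A (n + 1)) (F n)) : IsAdapted e F ⊥ where
  summand_mem n x hx i hi := by
    have : x = 0 := Subtype.ext hx
    simp [this] at hi
  inf_sup_mem n := by simpa using (hF n).bot_mem

theorem IsAdapted.sSup_of_isChain (hF : ∀ n, IsStepFamily (A n) (A (n + 1)) (F n))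
    {c : Set (Submodule R M)} (hne : c.Nonempty) (hch : IsChain (· ≤ ·) c)
    (hc : ∀ B ∈ c, IsAdapted e F B) : IsAdapted e F (sSup c) where
  summand_mem n x hx i hi z := by
    rw [Submodule.mem_sSup_of_directed hne hch.directedOn] at hx
    obtain ⟨B, hB, hx⟩ := hx
    exact (le_sSup hB : B ≤ _) ((hc B hB).summand_mem n x hx i hi z)
  inf_sup_mem n := by
    have hmono : Monotone fun B : Submodule R M => B ⊓ A (n + 1) ⊔ A n :=
      fun _ _ h => sup_le_sup_right (inf_le_inf_right _ h) _
    have hch' : IsChain (· ≤ ·) ((fun B => B ⊓ A (n + 1) ⊔ A n) '' c) := by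
      rintro _ ⟨B, hB, rfl⟩ _ ⟨B', hB', rfl⟩ -
      exact (hch.total hB hB').imp (fun h => hmono h) fun h => hmono h
    have heq : sSup c ⊓ A (n + 1) ⊔ A n = sSup ((fun B => B ⊓ A (n + 1) ⊔ A n) '' c) := by
      have hle : ∀ B ∈ c, B ⊓ A (n + 1) ⊔ A n ≤ sSup ((fun B => B ⊓ A (n + 1) ⊔ A n) '' c) :=
        fun B hB => le_sSup (Set.mem_image_of_mem _ hB)
      apply le_antisymm
      · refine sup_le ?_ ?_
        · rintro x ⟨hx, hxn⟩
          obtain ⟨B, hB, hx⟩ := (Submodule.mem_sSup_of_directed hne hch.directedOn).1 hx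
          exact hle B hB ((le_sup_left : B ⊓ A (n + 1) ≤ _) ⟨hx, hxn⟩)
        · obtain ⟨B, hB⟩ := hne
          exact le_sup_right.trans (hle B hB)
      · refine sSup_le ?_
        rintro _ ⟨B, hB, rfl⟩
        exact hmono (le_sSup hB)
    rw [heq]
    refine (hF n).sSup_mem _ ?_ (hne.image _) hch'
    rintro _ ⟨B, hB, rfl⟩
    exact (hc B hB).inf_sup_mem n

theorem IsAdapted.isRelDivisible_sup (hA_mono : Monotone A) (hA_union : ∀ x, ∃ n, x ∈ A n)
    (hA : ∀ n, IsRelDivisible (A n)) (hF : ∀ n, IsStepFamily (A n) (A (n + 1)) (F n))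
    {B : Submodule R M} (hB : IsAdapted e F B) (n : ℕ) : IsRelDivisible (B ⊔ A n) := by
  have key : ∀ m ≥ n, IsRelDivisible (B ⊓ A m ⊔ A n) := fun m hm => by
    induction m, hm using Nat.le_induction with
    | base => rw [sup_eq_right.2 inf_le_right]; exact hA n
    | succ m hm ih =>
      intro r hr x hx
      have hBm : B ⊓ A (m + 1) ⊔ A n ≤ B ⊓ A (m + 1) ⊔ A m := sup_le_sup_left (hA_mono hm) _
      obtain ⟨b, hb, y, hy, rfl⟩ := Submodule.mem_sup.1
        ((hF m).isRelDivisible _ (hB.inf_sup_mem m) r hr x (hBm hx))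
      have hry : r • y ∈ B ⊓ A m ⊔ A n := by
        have h : r • y ∈ B ⊓ A (m + 1) ⊔ A n := by
          have := sub_mem hx ((le_sup_left : _ ≤ B ⊓ A (m + 1) ⊔ A n)
            ((B ⊓ A (m + 1)).smul_mem r hb))
          simpa [smul_add] using this
        obtain ⟨b', hb', a, ha, h'⟩ := Submodule.mem_sup.1 h
        refine h' ▸ Submodule.add_mem_sup ⟨hb'.1, ?_⟩ ha
        rw [eq_sub_of_add_eq h']
        exact sub_mem ((A m).smul_mem r hy) (hA_mono hm ha)
      have hy' := ih r hr y hry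
      exact add_mem ((le_sup_left : _ ≤ B ⊓ A (m + 1) ⊔ A n) hb)
        (sup_le_sup_right (inf_le_inf_left B (hA_mono m.le_succ)) _ hy')
  intro r hr x hx
  obtain ⟨b, hb, a, ha, h⟩ := Submodule.mem_sup.1 hx
  obtain ⟨m, hm⟩ := hA_union b
  refine sup_le_sup_right (inf_le_left : B ⊓ A (max m n) ≤ B) _
    (key (max m n) (le_max_right _ _) r hr x ?_)
  exact h ▸ Submodule.add_mem_sup ⟨hb, hA_mono (le_max_left _ _) hm⟩ ha

theorem IsAdapted.exists_disjoint_sup_eq {B : Submodule R M} (hB : IsAdapted e F B) (n : ℕ) :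
    ∃ C, Disjoint (B ⊓ A n) C ∧ B ⊓ A n ⊔ C = A n := by
  classical
  let X : ι n → Prop := fun i => ∃ x : A n, (x : M) ∈ B ∧ e n x i ≠ 0
  -- The complement consists of the elements whose coordinates in the support of `B` vanish.
  let C : Submodule R (A n) :=
    { carrier := {x | ∀ i, X i → e n x i = 0}
      zero_mem' := fun i _ => by simp
      add_mem' := fun hx hy i hi => by
        rw [map_add, DirectSum.add_apply, hx i hi, hy i hi, add_zero]
      smul_mem' := fun r x hx i hi => by
        rw [map_smul, DirectSum.smul_apply, hx i hi, smul_zero] }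
  refine ⟨C.map (A n).subtype, ?_, le_antisymm (sup_le inf_le_right ?_) ?_⟩
  · rw [Submodule.disjoint_def]
    rintro _ ⟨hx, -⟩ ⟨x, hxC, rfl⟩
    have : e n x = 0 := DFinsupp.ext fun i => by
      by_contra hi
      exact hi (hxC i ⟨x, hx, hi⟩)
    simpa using this
  · rintro _ ⟨x, -, rfl⟩
    exact x.2
  · intro x hx
    rw [← Submodule.coe_mk x hx, eq_sum_summandIncl e n]
    refine sum_mem fun i _ => ?_
    by_cases hi : X i
    · obtain ⟨x', hx', hi'⟩ := hi
      exact (le_sup_left : B ⊓ A n ≤ _)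
        ⟨hB.summand_mem n x' hx' i hi' _, summandIncl_mem e n i _⟩
    · refine (le_sup_right : C.map (A n).subtype ≤ _) ⟨_, fun j hj => ?_, rfl⟩
      have hij : i ≠ j := fun h => hi (h ▸ hj)
      rw [LinearMap.comp_apply, LinearEquiv.coe_coe, LinearEquiv.apply_symm_apply]
      exact DirectSum.of_eq_of_ne _ _ _ hij.symm

theorem IsAdapted.isWellPlaced (hA_zero : A 0 = ⊥) (hA_mono : Monotone A)
    (hA_union : ∀ x, ∃ n, x ∈ A n)
    (hA : ∀ n, IsRelDivisible (A n)) (hF : ∀ n, IsStepFamily (A n) (A (n + 1)) (F n))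
    {B : Submodule R M} (hB : IsAdapted e F B) : IsWellPlaced A B where
  isRelDivisible := by
    simpa [hA_zero] using hB.isRelDivisible_sup hA_mono hA_union hA hF 0
  eventually := ⟨0, fun n _ =>
    ⟨hB.exists_disjoint_sup_eq n, hB.isRelDivisible_sup hA_mono hA_union hA hF n⟩⟩

end Adapted

/-! ### Countable adapted extensions -/

section Extension

variable {R : Type u} {M : Type v} [CommRing R] [IsDomain R] [AddCommGroup M] [Module R M]
  {A : ℕ → Submodule R M} {ι : ℕ → Type*} {I : ∀ n, ι n → Ideal R}
  {e : ∀ n, A n ≃ₗ[R] ⨁ i, ↥(I n i)} {F : ℕ → Set (Submodule R M)} {B : Submodule R M}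

/-- The summands of `A n` on which some element of the pure closure of `B + ⟨S⟩`, `S` countable, has
a nonzero coordinate lie in the pure closure of `B + ⟨U⟩` for some countable `U`. -/
theorem IsAdapted.exists_countable_summand_mem (hB : IsAdapted e F B) {S : Set M}
    (hS : S.Countable) (n : ℕ) :
    ∃ U : Set M, U.Countable ∧ ∀ x : A n, (x : M) ∈ pureClosure (B ⊔ Submodule.span R S) →
      ∀ i, e n x i ≠ 0 → ∀ z, summandIncl e n i z ∈ pureClosure (B ⊔ Submodule.span R U) := by
  classical
  obtain ⟨T, hT, hTQ, hle⟩ := exists_countable_subset_le_pureClosure (B := B)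
    (Q := pureClosure (B ⊔ Submodule.span R S) ⊓ A n) hS inf_le_left
  let T' : Set (A n) := Subtype.val ⁻¹' T
  let U : Set M := ⋃ t ∈ T',
    (fun i => summandIncl e n i (e n t i)) '' (DFinsupp.support (e n t) : Set (ι n))
  refine ⟨U, ?_, ?_⟩
  · exact (hT.preimage Subtype.val_injective).biUnion fun t _ =>
      (Finset.countable_toSet _).image _
  intro x hx i hi z
  obtain ⟨r, hr, h⟩ := hle ⟨hx, x.2⟩
  obtain ⟨b, hb, t, ht, h⟩ := Submodule.mem_sup.1 h
  have htn : t ∈ A n := Submodule.span_le.2 (fun y hy => (hTQ hy).2) ht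
  have hbn : b ∈ A n := by
    rw [eq_sub_of_add_eq h]
    exact sub_mem ((A n).smul_mem r x.2) htn
  by_cases hbi : e n ⟨b, hbn⟩ i = 0
  · -- Otherwise all elements of `T` have vanishing `i`-th coordinate, hence so has `r • x`.
    have hti : ∃ t' ∈ T', e n t' i ≠ 0 := by
      by_contra! hall
      have hspan : Submodule.span R T ≤ (LinearMap.ker
          (DirectSum.component R (ι n) (fun i => I n i) i ∘ₗ (e n).toLinearMap)).map
          (A n).subtype :=
        Submodule.span_le.2 fun y hy => ⟨⟨y, (hTQ hy).2⟩, hall ⟨y, (hTQ hy).2⟩ hy, rfl⟩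
      obtain ⟨t', ht', rfl⟩ := hspan ht
      have hrx : r • x = ⟨b, hbn⟩ + t' := Subtype.ext h.symm
      have h0 : r • e n x i = 0 := by
        rw [← DirectSum.smul_apply, ← map_smul, hrx, map_add, DirectSum.add_apply, hbi, zero_add]
        exact ht'
      exact hi ((smul_eq_zero.1 h0).resolve_left hr)
    obtain ⟨t', ht', hti⟩ := hti
    refine ⟨e n t' i, fun h0 => hti (Subtype.ext h0), ?_⟩
    have hcomm : (e n t' i : R) • z = (z : R) • e n t' i := Subtype.ext (mul_comm _ _)
    rw [← map_smul, hcomm, map_smul]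
    refine (le_sup_right : _ ≤ B ⊔ _) (Submodule.smul_mem _ _ (Submodule.subset_span ?_))
    exact Set.mem_biUnion ht' ⟨i, by simpa using hti, rfl⟩
  · exact le_pureClosure _ ((le_sup_left : B ≤ _) (hB.summand_mem n ⟨b, hbn⟩ hb i hbi z))

/-- A member `D` of the family that is generated, modulo `N`, by elements of the pure closure of
`B + ⟨S⟩` is contained in a member `D'` that contains the trace of this pure closure on `P` and is
generated, modulo `N`, by elements of the pure closure of `B + ⟨S ∪ U⟩`, with `U` countable. -/
theorem IsStepFamily.exists_countable_extension {N P : Submodule R M} {F : Set (Submodule R M)}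
    (hF : IsStepFamily N P F) {S : Set M} (hS : S.Countable) {D : Submodule R M} (hD : D ∈ F)
    (hBD : B ⊓ P ≤ D) (hDS : D ≤ pureClosure (B ⊔ Submodule.span R S) ⊓ P ⊔ N) :
    ∃ U : Set M, U.Countable ∧ ∃ D' ∈ F, D ≤ D' ∧
      pureClosure (B ⊔ Submodule.span R S) ⊓ P ≤ D' ∧
      ∀ V : Set M, S ⊆ V → U ⊆ V → D' ≤ pureClosure (B ⊔ Submodule.span R V) ⊓ P ⊔ N := by
  obtain ⟨T, hT, hTQ, hle⟩ := exists_countable_subset_le_pureClosure (B := B)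
    (Q := pureClosure (B ⊔ Submodule.span R S) ⊓ P) hS inf_le_left
  have hTP : T ⊆ P := fun y hy => (hTQ hy).2
  obtain ⟨D', hD', hDD', hTD', U, hU, rfl⟩ := hF.exists_extension D hD T hT hTP
  refine ⟨U, hU, _, hD', hDD', ?_, fun V hSV hUV => sup_le (hDS.trans ?_) ?_⟩
  · rintro x ⟨hx, hxP⟩
    obtain ⟨r, hr, h⟩ := hle ⟨hx, hxP⟩
    obtain ⟨b, hb, t, ht, h⟩ := Submodule.mem_sup.1 h
    refine hF.isRelDivisible _ hD' r hr x (h ▸ add_mem (hDD' (hBD ⟨hb, ?_⟩)) ?_)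
    · rw [eq_sub_of_add_eq h]
      exact sub_mem (P.smul_mem r hxP) (Submodule.span_le.2 hTP ht)
    · exact Submodule.span_le.2 hTD' ht
  · exact sup_le_sup_right (inf_le_inf_right _
      (pureClosure_mono (sup_le_sup_left (Submodule.span_mono hSV) _))) _
  · refine le_sup_of_le_left (Submodule.span_le.2 fun y hy => ⟨?_, ?_⟩)
    · exact le_pureClosure _ ((le_sup_right : _ ≤ B ⊔ _) (Submodule.subset_span (hUV hy)))
    · exact hF.le_of_mem _ hD' ((le_sup_right : _ ≤ D ⊔ _) (Submodule.subset_span hy))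

/-- Adapted submodules have adapted extensions of countable rank containing a prescribed countable
set. This is a back-and-forth argument: the countable sets `S k` and the members `D k n` of the
`n`-th family are enlarged alternately, and the union of the pure closures of `B + ⟨S k⟩` is
adapted, its trace on `A (n + 1)` being the union of the `D k n`. -/
theorem IsAdapted.exists_countable_extension (hF : ∀ n, IsStepFamily (A n) (A (n + 1)) (F n))
    (hB : IsAdapted e F B) {H : Set M} (hH : H.Countable) :
    ∃ S : Set M, S.Countable ∧ H ⊆ S ∧ IsAdapted e F (pureClosure (B ⊔ Submodule.span R S)) := by
  let inv : Set M × (ℕ → Submodule R M) → Prop := fun p => p.1.Countable ∧ ∀ n, p.2 n ∈ F n ∧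
    B ⊓ A (n + 1) ≤ p.2 n ∧ p.2 n ≤ pureClosure (B ⊔ Submodule.span R p.1) ⊓ A (n + 1) ⊔ A n
  have hstep : ∀ p : {p // inv p}, ∃ p' : {p // inv p}, p.1.1 ⊆ p'.1.1 ∧
      (∀ n, p.1.2 n ≤ p'.1.2 n) ∧
      (∀ n, pureClosure (B ⊔ Submodule.span R p.1.1) ⊓ A (n + 1) ≤ p'.1.2 n) ∧
      ∀ (n : ℕ) (x : A n), (x : M) ∈ pureClosure (B ⊔ Submodule.span R p.1.1) →
        ∀ i, e n x i ≠ 0 → ∀ z, summandIncl e n i z ∈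
          pureClosure (B ⊔ Submodule.span R p'.1.1) := by
    rintro ⟨⟨S, D⟩, hS, hD⟩
    choose U hU hUx using fun n => hB.exists_countable_summand_mem hS n
    choose V hV D' hD' hDD' hSD' hD'le using fun n =>
      (hF n).exists_countable_extension hS (hD n).1 (hD n).2.1 (hD n).2.2
    let W : Set M := S ∪ ((⋃ n, U n) ∪ ⋃ n, V n)
    have hW : W.Countable :=
      hS.union ((Set.countable_iUnion hU).union (Set.countable_iUnion hV))
    have hSW : S ⊆ W := Set.subset_union_left
    have hUW : ∀ n, U n ⊆ W := fun n => (Set.subset_iUnion U n).trans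
      (Set.subset_union_left.trans Set.subset_union_right)
    have hVW : ∀ n, V n ⊆ W := fun n => (Set.subset_iUnion V n).trans
      (Set.subset_union_right.trans Set.subset_union_right)
    refine ⟨⟨⟨W, D'⟩, hW, fun n => ⟨hD' n, (hD n).2.1.trans (hDD' n), hD'le n W hSW (hVW n)⟩⟩,
      hSW, hDD', hSD', fun n x hx i hi z => ?_⟩
    exact pureClosure_mono (sup_le_sup_left (Submodule.span_mono (hUW n)) _) (hUx n x hx i hi z)
  choose next hsub hDle hSD hcoord using hstep
  let p₀ : {p // inv p} := ⟨⟨H, fun n => B ⊓ A (n + 1) ⊔ A n⟩, hH, fun n =>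
    ⟨hB.inf_sup_mem n, le_sup_left, sup_le_sup_right (inf_le_inf_right _
      (le_sup_left.trans (le_pureClosure _))) _⟩⟩
  let p : ℕ → {p // inv p} := fun k => next^[k] p₀
  have hp : ∀ k, p (k + 1) = next (p k) := fun k => Function.iterate_succ_apply' next k p₀
  have hSmono : Monotone fun k => (p k).1.1 := monotone_nat_of_le_succ fun k => by
    rw [hp]
    exact hsub (p k)
  have hDmono : ∀ n, Monotone fun k => (p k).1.2 n := fun n => monotone_nat_of_le_succ fun k => by
    rw [hp]
    exact hDle (p k) n
  refine ⟨⋃ k, (p k).1.1, Set.countable_iUnion fun k => (p k).2.1,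
    Set.subset_iUnion (fun k => (p k).1.1) 0, ⟨fun n x hx i hi z => ?_, fun n => ?_⟩⟩
  · rw [mem_pureClosure_sup_span_iUnion hSmono] at hx ⊢
    obtain ⟨k, hk⟩ := hx
    refine ⟨k + 1, ?_⟩
    rw [hp]
    exact hcoord (p k) n x hk i hi z
  · have heq : pureClosure (B ⊔ Submodule.span R (⋃ k, (p k).1.1)) ⊓ A (n + 1) ⊔ A n =
        sSup (Set.range fun k => (p k).1.2 n) := by
      have hle : ∀ k, (p k).1.2 n ≤ sSup (Set.range fun k => (p k).1.2 n) :=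
        fun k => le_sSup ⟨k, rfl⟩
      apply le_antisymm
      · refine sup_le ?_ (((hF n).ge_of_mem _ ((p 0).2.2 n).1).trans (hle 0))
        rintro x ⟨hx, hxn⟩
        obtain ⟨k, hk⟩ := (mem_pureClosure_sup_span_iUnion hSmono).1 hx
        refine hle (k + 1) ?_
        rw [hp]
        exact hSD (p k) n ⟨hk, hxn⟩
      · refine sSup_le ?_
        rintro _ ⟨k, rfl⟩
        exact ((p k).2.2 n).2.2.trans (sup_le_sup_right (inf_le_inf_right _ (pureClosure_mono
          (sup_le_sup_left (Submodule.span_mono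
            (Set.subset_iUnion (fun k => (p k).1.1) k)) _))) _)
    rw [heq]
    refine (hF n).sSup_mem _ ?_ (Set.range_nonempty _) (hDmono n).isChain_range
    rintro _ ⟨k, rfl⟩
    exact ((p k).2.2 n).1

end Extension

/-! ### Assembling the decomposition -/

theorem isIsoDirectSumOfIdeals_of_sSupIndep {R : Type u} {M : Type v} [CommRing R]
    [AddCommGroup M] [Module R M] {S : Set (Submodule R M)} (hS : sSupIndep S) (htop : sSup S = ⊤)
    (hSI : ∀ J ∈ S, ∃ f : J →ₗ[R] R, Function.Injective f) : IsIsoDirectSumOfIdeals R M := by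
  classical
  have hint : DirectSum.IsInternal (fun J : S => (J : Submodule R M)) :=
    DirectSum.isInternal_submodule_of_iSupIndep_of_iSup_eq_top ((sSupIndep_iff S).1 hS)
      (by rw [← sSup_eq_iSup', htop])
  choose f hf using fun J : S => hSI J J.2
  let g : (⨁ J : S, (J : Submodule R M)) ≃ₗ[R] ⨁ J : S, (LinearMap.range (f J) : Ideal R) :=
    DFinsupp.mapRange.linearEquiv fun J => LinearEquiv.ofInjective (f J) (hf J)
  exact ⟨S, fun J => LinearMap.range (f J),
    ⟨(LinearEquiv.ofBijective (DirectSum.coeLinearMap _) hint).symm.trans g⟩⟩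

theorem theorem6p13 (R : Type u) [CommRing R] (hPrufer : IsPruferDomain R)
    (hLocal : IsHLocalDomain R)
    (M : Type v) [AddCommGroup M] [Module R M] (hM : Module.IsTorsionFree R M)
    (A : ℕ → Submodule R M) (hA_zero : A 0 = ⊥) (hA_mono : ∀ n, A n ≤ A (n + 1))
    (hA_union : ∀ x : M, ∃ n, x ∈ A n)
    (hA_ideals : ∀ n, IsIsoDirectSumOfIdeals R (A n))
    (hA_family : ∀ n, ∃ C : Set (Submodule R (A (n + 1) ⧸ (A n).submoduleOf (A (n + 1)))),
      IsGAlephZeroFamily C ∧ ∀ D ∈ C, IsPureSubmodule D)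
    (hA_pure : ∀ n, IsPureSubmodule (A n)) :
    IsIsoDirectSumOfIdeals R M := by
  have := hPrufer.1
  have hmono : Monotone A := monotone_nat_of_le_succ hA_mono
  have hA : ∀ n, IsRelDivisible (A n) := fun n => (hA_pure n).isRelDivisible
  choose ι I he using hA_ideals
  let e := fun n => (he n).some
  have hF : ∀ n, ∃ F, IsStepFamily (A n) (A (n + 1)) F := fun n => by
    obtain ⟨C, hC, hpure⟩ := hA_family n
    exact hC.exists_isStepFamily (hA_mono n) (hA n) (hA (n + 1)) hpure
  choose F hF using hF
  let Z : Set (Set (Submodule R M)) := {S | sSupIndep S ∧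
    (∀ J ∈ S, ∃ f : J →ₗ[R] R, Function.Injective f) ∧ IsAdapted e F (sSup S)}
  obtain ⟨S, hSmax⟩ : ∃ S, Maximal (· ∈ Z) S := by
    refine zorn_subset Z fun c hc hch => ?_
    rcases c.eq_empty_or_nonempty with rfl | hne
    · refine ⟨∅, ⟨sSupIndep_empty, by simp, ?_⟩, by simp⟩
      rw [sSup_empty]
      exact isAdapted_bot hF
    · refine ⟨⋃₀ c, ⟨iSupIndep_sUnion_of_directed hch.directedOn fun S hS => (hc hS).1,
        fun J ⟨S, hS, hJ⟩ => (hc hS).2.1 J hJ, ?_⟩, fun S hS => Set.subset_sUnion_of_mem hS⟩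
      have hsup : sSup (⋃₀ c) = sSup (sSup '' c) := by rw [sSup_sUnion, sSup_image]
      rw [hsup]
      refine IsAdapted.sSup_of_isChain hF (hne.image _) ?_ ?_
      · rintro _ ⟨S, hS, rfl⟩ _ ⟨T, hT, rfl⟩ -
        exact (hch.total hS hT).imp (fun h => sSup_le_sSup h) fun h => sSup_le_sSup h
      · rintro _ ⟨S, hS, rfl⟩
        exact (hc hS).2.2
  obtain ⟨hS, hSI, hSA⟩ := hSmax.prop
  refine isIsoDirectSumOfIdeals_of_sSupIndep hS ?_ hSI
  rw [eq_top_iff]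
  intro x _
  obtain ⟨T, hT, hxT, hTA⟩ := hSA.exists_countable_extension hF (Set.countable_singleton x)
  have hxT' : x ∈ T := hxT rfl
  obtain ⟨y, rfl⟩ := hT.exists_eq_range ⟨x, hxT'⟩
  have hSw := hSA.isWellPlaced hA_zero hmono hA_union hA hF
  obtain ⟨S', hSS', hS', hSI', hsup⟩ :=
    hSw.exists_sSupIndep hPrufer hLocal hmono hA_union hA e hS hSI y
  have hS'Z : S' ∈ Z := ⟨hS', hSI', hsup ▸ hTA⟩
  have hle : sSup S' ≤ sSup S := sSup_le_sSup (hSmax.le_of_ge hS'Z hSS')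
  refine hle ?_
  rw [hsup]
  exact le_pureClosure _ ((le_sup_right : _ ≤ sSup S ⊔ _) (Submodule.subset_span hxT'))
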